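/- Let $\mathcal X$ and $E$ be Polish spaces with $\mathcal X$ compact and nonempty. Let $h:\mathcal X\times E\to\mathbb R$ be jointly continuous and bounded from below, with compact sub-level sets $\{(x,w)\in\mathcal X\times E: h(x,w)\le c\}$, $c\in\mathbb R$. Let $q\in(1,\infty)$, let $\mu$ be a Borel probability measure on $E$, and suppose that $$\int_E\psi^q\,d\mu<\infty,\qquad\text{where } \psi(w):=\Big(\sup_{x\in\mathcal X}h(x,w)\Big)^+ .$$ For a Borel probability measure $\nu$ on $E$ with $\int_E\psi\,d\nu<\infty$ put $V(\nu)=\inf_{x\in\mathcal X}\int_E h(x,w)\,\nu(dw)$. For $n\ge1$ let $L_n:E^n\to\mathcal P(E)$, $L_n(w_1,\dots,w_n)=\frac1n\sum_{i=1}^n\delta_{w_i}$, be the empirical measure, and let $\mu^n$ be the $n$-fold product measure on $E^n$. Then for every $\varepsilon>0$, $$\limsup_{n\to\infty}\,n^{q-1}\,\mu^n\big(|V(L_n)-V(\mu)|\ge\varepsilon\big)<\infty .$$ -/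

import Mathlib

open MeasureTheory Filter
open scoped ENNReal

noncomputable section

/-- The value `V(ν) = inf_x ∫ h(x, w) ν(dw)` of the stochastic optimization problem with cost `h`.
It is used below only at measures `ν` for which every `h(x, ·)` is integrable and for which the
infimum is over a nonempty family that is bounded from below; see
`integrable_cost` and `bddBelow_range_integral_cost`. -/
def optValue {X E : Type*} [MeasurableSpace E] (h : X × E → ℝ) (ν : Measure E) : ℝ :=
  ⨅ x : X, ∫ w, h (x, w) ∂ν

/-- The envelope `ψ(w) = (sup_x h(x, w))⁺`. -/
def envelope {X E : Type*} (h : X × E → ℝ) (w : E) : ℝ :=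
  max (⨆ x : X, h (x, w)) 0

/-- The empirical measure `L_n(w_1, …, w_n) = (1/n) ∑ δ_{w_i}` (for `n ≥ 1`). -/
def empiricalMeasure {E : Type*} [MeasurableSpace E] {n : ℕ} (w : Fin n → E) : Measure E :=
  (n : ℝ≥0∞)⁻¹ • ∑ i : Fin n, Measure.dirac (w i)

theorem le_envelope {X E : Type*} [TopologicalSpace X] [CompactSpace X] [TopologicalSpace E]
    {h : X × E → ℝ} (hcont : Continuous h) (x : X) (w : E) : h (x, w) ≤ envelope h w :=
  (le_ciSup (isCompact_range (f := fun x : X => h (x, w)) (by fun_prop)).bddAbove x).trans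
    (le_max_left _ _)

/-- Under the assumptions of the theorem each cost `h(x, ·)` is `μ`-integrable. -/
theorem integrable_cost {X E : Type*} [TopologicalSpace X] [CompactSpace X]
    [TopologicalSpace E] [MeasurableSpace E] [BorelSpace E]
    {h : X × E → ℝ} (hcont : Continuous h) (hbdd : BddBelow (Set.range h))
    {q : ℝ} (hq : 1 < q) {μ : Measure E} [IsProbabilityMeasure μ]
    (hψ : ∫⁻ w, ENNReal.ofReal (envelope h w ^ q) ∂μ < ∞) (x : X) :
    Integrable (fun w => h (x, w)) μ := by
  obtain ⟨c, hc⟩ := hbdd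
  have hm : Continuous fun w => h (x, w) := by fun_prop
  refine ⟨hm.aestronglyMeasurable, ?_⟩
  have hle : ∀ w, ‖h (x, w)‖ₑ ≤
      ENNReal.ofReal (|c| + 1) + ENNReal.ofReal (envelope h w ^ q) := by
    intro w
    have h0 : 0 ≤ envelope h w := le_max_right _ _
    have h1 : c ≤ h (x, w) := hc ⟨_, rfl⟩
    have h2 := le_envelope hcont x w
    have h3 : envelope h w ≤ 1 + envelope h w ^ q := by
      rcases le_total (envelope h w) 1 with h4 | h4
      · linarith [Real.rpow_nonneg h0 q]
      · linarith [Real.self_le_rpow_of_one_le h4 hq.le]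
    rw [← ENNReal.ofReal_add (by positivity) (Real.rpow_nonneg h0 q), Real.enorm_eq_ofReal_abs]
    refine ENNReal.ofReal_le_ofReal (abs_le.2 ⟨?_, ?_⟩)
    · linarith [neg_abs_le c, Real.rpow_nonneg h0 q]
    · linarith [abs_nonneg c]
  refine (lintegral_mono hle).trans_lt ?_
  rw [lintegral_add_left measurable_const]
  simpa using hψ

/-- The infimum defining the value is over a family bounded from below. -/
theorem bddBelow_range_integral_cost {X E : Type*} [MeasurableSpace E]
    {h : X × E → ℝ} (hbdd : BddBelow (Set.range h)) (ν : Measure E) [IsProbabilityMeasure ν]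
    (hint : ∀ x, Integrable (fun w => h (x, w)) ν) :
    BddBelow (Set.range fun x : X => ∫ w, h (x, w) ∂ν) := by
  obtain ⟨c, hc⟩ := hbdd
  refine ⟨c, ?_⟩
  rintro _ ⟨x, rfl⟩
  simpa using integral_mono (integrable_const c) (hint x) (fun w => hc ⟨_, rfl⟩)

end

/-! An infimum is 1-Lipschitz in the sup norm, so it suffices to control the deviation of the
empirical means of `h (x, ·)` uniformly in `x`. By compactness finitely many neighbourhoods cover
`X`, on each of which the oscillation of the cost has small mean
(`exists_mem_nhds_integral_costOsc_lt`). The bad event then lies in finitely many deviation events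
for single functions: `h (x, ·)`, its negative and its oscillation, all dominated by `ψ` plus a
constant up to a factor, hence in `L^q`. For one such function,
`eventually_rpow_mul_measureReal_pi_sum_ge_le` gives a tail of order `n ^ (1 - q)`. A single summand
above `d * n` costs `n * μ(f > d * n)`, which Markov's inequality bounds at that order; without such
a jump, an exponential bound with parameter of order `log n / n` gives the same order. -/

/-! ### Polynomial tail bounds for i.i.d. sums. -/

/-- Replacing the quadratic Taylor remainder by a `p`-th power lets a `p`-th moment stand in for the
variance. -/
theorem Real.exp_le_one_add_add_rpow_mul_exp {p : ℝ} (hp1 : 1 ≤ p) (hp2 : p ≤ 2) (u : ℝ) :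
    Real.exp u ≤ 1 + u + |u| ^ p * Real.exp (max u 0) := by
  have hp0 : 0 < p := by linarith
  have he : 1 ≤ Real.exp (max u 0) := Real.one_le_exp (le_max_right _ _)
  have hnn : 0 ≤ |u| ^ p := Real.rpow_nonneg (abs_nonneg u) p
  have hle : |u| ^ p ≤ |u| ^ p * Real.exp (max u 0) := le_mul_of_one_le_right hnn he
  rcases le_total |u| 1 with h1 | h1
  · have h2 : u ^ 2 ≤ |u| ^ p := by
      rw [← sq_abs, ← Real.rpow_natCast]
      exact Real.rpow_le_rpow_of_exponent_ge_of_imp (abs_nonneg u) h1 (by exact_mod_cast hp2)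
        (fun _ h => absurd h two_ne_zero)
    have h3 := (abs_le.1 (Real.abs_exp_sub_one_sub_id_le h1)).2
    linarith
  · have h4 : |u| ≤ |u| ^ p := Real.self_le_rpow_of_one_le h1 hp1
    rcases le_total u 0 with h5 | h5
    · have h6 : Real.exp u ≤ 1 := Real.exp_le_one_iff.2 h5
      rw [abs_of_nonpos h5] at *
      linarith
    · rw [max_eq_left h5, abs_of_nonneg h5] at *
      nlinarith [Real.exp_pos u]

section

variable {E : Type*} [MeasurableSpace E] {μ : Measure E} [IsProbabilityMeasure μ]

theorem integrable_exp_mul_min {f : E → ℝ} (hf : Measurable f) {l y : ℝ} (hl : 0 ≤ l) :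
    Integrable (fun w => Real.exp (l * min (f w) y)) μ := by
  refine Integrable.of_bound (C := Real.exp (l * y)) (by fun_prop) (ae_of_all _ fun w => ?_)
  rw [Real.norm_eq_abs, Real.abs_exp]
  exact Real.exp_le_exp.2 (mul_le_mul_of_nonneg_left (min_le_right _ _) hl)

/-- Truncation from above only lowers `f`, so the linear term is still at most `l * ∫ f = 0`. -/
theorem integral_exp_mul_min_le {f : E → ℝ} (hf : Measurable f) (hint : Integrable f μ)
    (hzero : ∫ w, f w ∂μ = 0) {p : ℝ} (hp1 : 1 ≤ p) (hp2 : p ≤ 2)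
    (hfp : Integrable (fun w => |f w| ^ p) μ) {l y : ℝ} (hl : 0 ≤ l) (hy : 0 ≤ y) :
    ∫ w, Real.exp (l * min (f w) y) ∂μ ≤
      1 + l ^ p * Real.exp (l * y) * ∫ w, |f w| ^ p ∂μ := by
  have hle : ∀ w, Real.exp (l * min (f w) y) ≤
      1 + l * f w + l ^ p * Real.exp (l * y) * |f w| ^ p := by
    intro w
    have habs : |min (f w) y| ≤ |f w| := by
      rcases le_total (f w) y with h | h
      · rw [min_eq_left h]
      · rw [min_eq_right h, abs_of_nonneg hy, abs_of_nonneg (hy.trans h)]; exact h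
    have h1 := Real.exp_le_one_add_add_rpow_mul_exp hp1 hp2 (l * min (f w) y)
    rw [abs_mul, abs_of_nonneg hl, Real.mul_rpow hl (abs_nonneg _)] at h1
    have h2 : l * min (f w) y ≤ l * f w := mul_le_mul_of_nonneg_left (min_le_left _ _) hl
    have h3 : max (l * min (f w) y) 0 ≤ l * y :=
      max_le (mul_le_mul_of_nonneg_left (min_le_right _ _) hl) (by positivity)
    have h4 : l ^ p * |min (f w) y| ^ p * Real.exp (max (l * min (f w) y) 0) ≤
        l ^ p * |f w| ^ p * Real.exp (l * y) := by
      gcongr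
    linarith
  calc ∫ w, Real.exp (l * min (f w) y) ∂μ
      ≤ ∫ w, (1 + l * f w + l ^ p * Real.exp (l * y) * |f w| ^ p) ∂μ :=
        integral_mono (integrable_exp_mul_min hf hl)
          (((integrable_const _).add (hint.const_mul _)).add (hfp.const_mul _)) hle
    _ = _ := by
        rw [integral_add (f := fun w => 1 + l * f w)
            ((integrable_const _).add (hint.const_mul _)) (hfp.const_mul _),
          integral_add (integrable_const _) (hint.const_mul _), integral_const_mul,
          integral_const_mul, hzero]
        simp

/-- A Fuk–Nagaev type inequality: truncation at level `y` and the exponential Markov inequality. -/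
theorem measureReal_pi_sum_ge_le {f : E → ℝ} (hf : Measurable f) (hint : Integrable f μ)
    (hzero : ∫ w, f w ∂μ = 0) {p : ℝ} (hp1 : 1 ≤ p) (hp2 : p ≤ 2)
    (hfp : Integrable (fun w => |f w| ^ p) μ) {l y : ℝ} (hl : 0 ≤ l) (hy : 0 ≤ y) (n : ℕ) (t : ℝ) :
    (Measure.pi fun _ : Fin n => μ).real {w | t ≤ ∑ i, f (w i)} ≤
      n * μ.real {w | y < f w} +
        Real.exp (-(l * t)) * Real.exp (n * (l ^ p * Real.exp (l * y) * ∫ w, |f w| ^ p ∂μ)) := by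
  set P := Measure.pi fun _ : Fin n => μ
  set S : Set (Fin n → E) := {w | Real.exp (l * t) ≤ ∏ i, Real.exp (l * min (f (w i)) y)}
  have hsub : {w : Fin n → E | t ≤ ∑ i, f (w i)} ⊆ (⋃ i, {w | y < f (w i)}) ∪ S := by
    intro w hw
    by_cases h : ∃ i, y < f (w i)
    · exact Or.inl (Set.mem_iUnion.2 h)
    · push Not at h
      right
      have : ∀ i, min (f (w i)) y = f (w i) := fun i => min_eq_left (h i)
      simp only [S, Set.mem_ofPred_eq, this, ← Real.exp_sum, ← Finset.mul_sum]
      exact Real.exp_le_exp.2 (mul_le_mul_of_nonneg_left hw hl)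
  have h1 : P.real (⋃ i, {w : Fin n → E | y < f (w i)}) ≤ n * μ.real {w | y < f w} := by
    refine (measureReal_iUnion_fintype_le _).trans ?_
    have : ∀ i, P.real {w : Fin n → E | y < f (w i)} = μ.real {w | y < f w} := fun i =>
      (measurePreserving_eval (fun _ : Fin n => μ) i).measureReal_preimage
        (measurableSet_lt measurable_const hf).nullMeasurableSet
    simp [this]
  have h2 : P.real S ≤ Real.exp (-(l * t)) *
      Real.exp (n * (l ^ p * Real.exp (l * y) * ∫ w, |f w| ^ p ∂μ)) := by
    have hM : 0 ≤ ∫ w, |f w| ^ p ∂μ := integral_nonneg fun w => by positivity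
    have hexp : Integrable (fun w : Fin n → E => ∏ i, Real.exp (l * min (f (w i)) y)) P :=
      Integrable.fintype_prod (f := fun _ w => Real.exp (l * min (f w) y))
        fun _ => integrable_exp_mul_min hf hl
    have h3 := mul_meas_ge_le_integral_of_nonneg (μ := P)
      (ae_of_all _ fun w => Finset.prod_nonneg fun i _ => (Real.exp_pos _).le) hexp
      (Real.exp (l * t))
    rw [integral_fintype_prod_eq_pow (fun w => Real.exp (l * min (f w) y)),
      Fintype.card_fin] at h3
    have h4 : (∫ w, Real.exp (l * min (f w) y) ∂μ) ^ n ≤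
        Real.exp (n * (l ^ p * Real.exp (l * y) * ∫ w, |f w| ^ p ∂μ)) := by
      rw [Real.exp_nat_mul]
      refine pow_le_pow_left₀ (integral_nonneg fun w => (Real.exp_pos _).le) ?_ n
      refine (integral_exp_mul_min_le hf hint hzero hp1 hp2 hfp hl hy).trans ?_
      rw [add_comm]
      exact Real.add_one_le_exp _
    rw [Real.exp_neg, ← div_eq_inv_mul, le_div_iff₀ (Real.exp_pos _), mul_comm]
    exact h3.trans h4
  exact (measureReal_mono hsub).trans ((measureReal_union_le _ _).trans (add_le_add h1 h2))

/-- Polynomial tail bound of order `n ^ (1 - q)` for the sum of `n` independent copies of a centered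
random variable with finite `q`-th moment. -/
theorem eventually_rpow_mul_measureReal_pi_sum_ge_le {f : E → ℝ} (hf : Measurable f)
    (hzero : ∫ w, f w ∂μ = 0) {q : ℝ} (hq : 1 < q) (hfq : MemLp f (ENNReal.ofReal q) μ)
    {η : ℝ} (hη : 0 < η) :
    ∃ C : ℝ, ∀ᶠ n : ℕ in atTop, (n : ℝ) ^ (q - 1) *
      (Measure.pi fun _ : Fin n => μ).real {w | n * η ≤ ∑ i, f (w i)} ≤ C := by
  have hq0 : 0 < q := by linarith
  -- The exponential estimate needs `p ≤ 2`, the moment `p ≤ q`, and the decay of `n ^ (1 - p)`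
  -- needs `1 < p`.
  obtain ⟨p, hp1, hp2, hpq⟩ : ∃ p : ℝ, 1 < p ∧ p ≤ 2 ∧ p ≤ q :=
    ⟨min q 2, lt_min hq (by norm_num), min_le_right _ _, min_le_left _ _⟩
  have hp0 : 0 < p := by linarith
  have hint : Integrable f μ := hfq.integrable (by simpa using hq.le)
  have habs : ∀ r : ℝ, 0 < r → r ≤ q → Integrable (fun w => |f w| ^ r) μ := by
    intro r hr hrq
    have := (hfq.mono_exponent (ENNReal.ofReal_le_ofReal hrq)).integrable_norm_rpow
      (by simpa using hr) (by simp)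
    simpa [ENNReal.toReal_ofReal hr.le] using this
  have hfp := habs p hp0 hpq
  have hfq' := habs q hq0 le_rfl
  set M := ∫ w, |f w| ^ p ∂μ
  have hM : 0 ≤ M := integral_nonneg fun w => by positivity
  -- With `l = a * log n / n`, this makes `exp (-l * n * η)` equal to `n ^ (1 - q)`.
  set a : ℝ := (q - 1) / η with ha
  have ha0 : 0 < a := div_pos (by linarith) hη
  -- With `y = d * n`, `exp (l * y)` is `n ^ ((p - 1) / 2)`: it uses half of the decay of `n * l ^
  -- p`, and the other half absorbs `(log n) ^ p`.
  set d : ℝ := (p - 1) / (2 * a) with hd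
  have hd0 : 0 < d := div_pos (by linarith) (by positivity)
  have had : a * d = (p - 1) / 2 := by rw [hd]; field_simp
  have haη : a * η = q - 1 := by rw [ha]; field_simp
  refine ⟨(∫ w, |f w| ^ q ∂μ) / d ^ q + Real.exp (a ^ p * M), ?_⟩
  have hlog := ((isLittleO_log_rpow_rpow_atTop p (s := (p - 1) / 2) (by linarith)).comp_tendsto
    tendsto_natCast_atTop_atTop).bound (c := 1) one_pos
  filter_upwards [hlog, eventually_ge_atTop 1] with n hn hn1
  have hnR : (1 : ℝ) ≤ n := by exact_mod_cast hn1
  have hn0 : (0 : ℝ) < n := by linarith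
  have hL : 0 ≤ Real.log n := Real.log_nonneg hnR
  have hmain := measureReal_pi_sum_ge_le hf hint hzero hp1.le hp2 hfp
    (l := a * Real.log n / n) (y := d * n) (by positivity) (by positivity) n (n * η)
  have hmk : (n : ℝ) ^ (q - 1) * (n * μ.real {w | d * n < f w}) ≤
      (∫ w, |f w| ^ q ∂μ) / d ^ q := by
    have h1 := mul_meas_ge_le_integral_of_nonneg (μ := μ)
      (ae_of_all _ fun w => Real.rpow_nonneg (abs_nonneg (f w)) q) hfq' ((d * n) ^ q)
    have h2 : μ.real {w | d * n < f w} ≤ μ.real {w | (d * n) ^ q ≤ |f w| ^ q} := by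
      refine measureReal_mono fun w hw => ?_
      exact Real.rpow_le_rpow (by positivity) ((le_of_lt hw).trans (le_abs_self _)) hq0.le
    rw [le_div_iff₀ (by positivity)]
    calc (n : ℝ) ^ (q - 1) * (n * μ.real {w | d * n < f w}) * d ^ q
        = (d * n) ^ q * μ.real {w | d * n < f w} := by
          rw [Real.mul_rpow hd0.le hn0.le, Real.rpow_sub_one hn0.ne']
          field_simp
      _ ≤ _ := (mul_le_mul_of_nonneg_left h2 (by positivity)).trans h1
  have he1 : Real.exp (-(a * Real.log n / n * (n * η))) = ((n : ℝ) ^ (q - 1))⁻¹ := by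
    rw [Real.exp_neg, Real.rpow_def_of_pos hn0, ← haη]
    congr 2
    field_simp
  have he2 : Real.exp (a * Real.log n / n * (d * n)) = (n : ℝ) ^ ((p - 1) / 2) := by
    rw [Real.rpow_def_of_pos hn0, ← had]
    congr 1
    field_simp
  have hlog' : Real.log n ^ p ≤ (n : ℝ) ^ ((p - 1) / 2) := by
    have h0 : 0 ≤ Real.log n ^ p := Real.rpow_nonneg hL p
    have h1 : 0 ≤ (n : ℝ) ^ ((p - 1) / 2) := by positivity
    simpa [abs_of_nonneg h0, abs_of_nonneg h1] using hn
  have he3 : (n : ℝ) * ((a * Real.log n / n) ^ p * (n : ℝ) ^ ((p - 1) / 2) * M) ≤ a ^ p * M := by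
    rw [Real.div_rpow (by positivity) hn0.le, Real.mul_rpow ha0.le hL]
    have hnp : (n : ℝ) ^ p = n * ((n : ℝ) ^ ((p - 1) / 2) * (n : ℝ) ^ ((p - 1) / 2)) := by
      rw [← Real.rpow_add hn0, ← Real.rpow_one_add' hn0.le (by linarith)]
      congr 1; ring
    have hpos : 0 < (n : ℝ) ^ ((p - 1) / 2) := by positivity
    have : (n : ℝ) * (a ^ p * Real.log n ^ p / (n : ℝ) ^ p * (n : ℝ) ^ ((p - 1) / 2) * M) =
        (a ^ p * M) * (Real.log n ^ p / (n : ℝ) ^ ((p - 1) / 2)) := by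
      rw [hnp]; field_simp
    rw [this]
    exact mul_le_of_le_one_right (by positivity) ((div_le_one hpos).2 hlog')
  rw [he1, he2] at hmain
  have hnq : 0 < (n : ℝ) ^ (q - 1) := by positivity
  calc _ ≤ (n : ℝ) ^ (q - 1) * _ := mul_le_mul_of_nonneg_left hmain hnq.le
    _ ≤ _ := by
      rw [mul_add, mul_inv_cancel_left₀ hnq.ne']
      exact add_le_add hmk (Real.exp_le_exp.2 he3)

theorem eventually_rpow_mul_measureReal_pi_average_sub_ge_le {f : E → ℝ} (hf : Measurable f)
    {q : ℝ} (hq : 1 < q) (hfq : MemLp f (ENNReal.ofReal q) μ) {η : ℝ} (hη : 0 < η) :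
    ∃ C : ℝ, ∀ᶠ n : ℕ in atTop, (n : ℝ) ^ (q - 1) *
      (Measure.pi fun _ : Fin n => μ).real
        {w | η ≤ (n : ℝ)⁻¹ * ∑ i, f (w i) - ∫ w, f w ∂μ} ≤ C := by
  have hint : Integrable f μ := hfq.integrable (by simpa using hq.le)
  obtain ⟨C, hC⟩ := eventually_rpow_mul_measureReal_pi_sum_ge_le (μ := μ)
    (f := fun w => f w - ∫ w, f w ∂μ) (hf.sub_const _)
    (by rw [integral_sub hint (integrable_const _)]; simp) hq (hfq.sub (memLp_const _)) hη
  refine ⟨C, ?_⟩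
  filter_upwards [hC, eventually_ge_atTop 1] with n hn hn1
  have hn0 : (0 : ℝ) < n := by exact_mod_cast hn1
  refine le_trans (le_of_eq ?_) hn
  congr 2
  ext w
  simp only [Set.mem_ofPred_eq, Finset.sum_sub_distrib, Finset.sum_const, Finset.card_univ,
    Fintype.card_fin, nsmul_eq_mul]
  rw [← mul_le_mul_iff_of_pos_left hn0, mul_sub, mul_inv_cancel_left₀ hn0.ne']

end

/-! ### Stability of infima, and integration against empirical measures. -/

theorem abs_ciInf_sub_ciInf_le {ι : Type*} [Nonempty ι] {a b : ι → ℝ}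
    (ha : BddBelow (Set.range a)) (hb : BddBelow (Set.range b)) {δ : ℝ}
    (hab : ∀ i, |a i - b i| ≤ δ) : |(⨅ i, a i) - ⨅ i, b i| ≤ δ := by
  have h1 : (⨅ i, a i) - δ ≤ ⨅ i, b i := le_ciInf fun i => by
    linarith [ciInf_le ha i, (abs_le.1 (hab i)).2]
  have h2 : (⨅ i, b i) - δ ≤ ⨅ i, a i := le_ciInf fun i => by
    linarith [ciInf_le hb i, (abs_le.1 (hab i)).1]
  exact abs_le.2 ⟨by linarith, by linarith⟩

theorem integrable_empiricalMeasure {E : Type*} [MeasurableSpace E] [MeasurableSingletonClass E]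
    {n : ℕ} (hn : n ≠ 0) (w : Fin n → E) (f : E → ℝ) : Integrable f (empiricalMeasure w) :=
  (integrable_finsetSum_measure.2 fun i _ => integrable_dirac (by simp)).smul_measure
    (by simpa using hn)

theorem integral_empiricalMeasure {E : Type*} [MeasurableSpace E] [MeasurableSingletonClass E]
    {n : ℕ} (w : Fin n → E) (f : E → ℝ) :
    ∫ e, f e ∂(empiricalMeasure w) = (n : ℝ)⁻¹ * ∑ i, f (w i) := by
  rw [empiricalMeasure, integral_smul_measure,
    integral_finsetSum_measure fun i _ => integrable_dirac (by simp)]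
  simp

theorem isProbabilityMeasure_empiricalMeasure {E : Type*} [MeasurableSpace E] {n : ℕ}
    (hn : n ≠ 0) (w : Fin n → E) : IsProbabilityMeasure (empiricalMeasure w) := by
  refine ⟨?_⟩
  simp [empiricalMeasure, ENNReal.inv_mul_cancel, hn]

/-! ### Local oscillation of the cost. -/

/-- The oscillation `sup_{y ∈ U} |h(y, w) - h(x, w)|` of the cost over `U` around `x`. -/
noncomputable def costOsc {X E : Type*} (h : X × E → ℝ) (x : X) (U : Set X) (w : E) : ℝ :=
  ⨆ y : U, |h (y, w) - h (x, w)|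

section

variable {X E : Type*} [TopologicalSpace X] [CompactSpace X] [TopologicalSpace E]
  {h : X × E → ℝ}

theorem bddAbove_range_abs_cost_sub (hcont : Continuous h) (x : X) (U : Set X) (w : E) :
    BddAbove (Set.range fun y : U => |h (y, w) - h (x, w)|) := by
  refine (isCompact_range (f := fun y : X => |h (y, w) - h (x, w)|) (by fun_prop)).bddAbove.mono ?_
  rintro _ ⟨y, rfl⟩
  exact ⟨y, rfl⟩

theorem abs_cost_sub_le_costOsc (hcont : Continuous h) {x y : X} {U : Set X} (hy : y ∈ U) (w : E) :
    |h (y, w) - h (x, w)| ≤ costOsc h x U w :=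
  le_ciSup (bddAbove_range_abs_cost_sub hcont x U w) ⟨y, hy⟩

omit [TopologicalSpace X] [CompactSpace X] [TopologicalSpace E] in
theorem costOsc_nonneg (x : X) (U : Set X) (w : E) : 0 ≤ costOsc h x U w :=
  Real.iSup_nonneg fun _ => abs_nonneg _

/-- A supremum of continuous functions is lower semicontinuous, so an uncountable `U` does no harm.
-/
theorem measurable_costOsc [MeasurableSpace E] [BorelSpace E] (hcont : Continuous h) (x : X)
    (U : Set X) : Measurable (costOsc h x U) :=
  (lowerSemicontinuous_ciSup (bddAbove_range_abs_cost_sub hcont x U) fun y =>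
    Continuous.lowerSemicontinuous (by fun_prop)).measurable

omit [TopologicalSpace X] [CompactSpace X] [TopologicalSpace E] in
theorem costOsc_le {G : E → ℝ} (hG : ∀ x w, |h (x, w)| ≤ G w) (x : X) (U : Set X) (w : E) :
    costOsc h x U w ≤ 2 * G w := by
  refine Real.iSup_le (fun y => ?_) ?_
  · linarith [abs_sub (h (y, w)) (h (x, w)), hG y w, hG x w]
  · linarith [abs_nonneg (h (x, w)), hG x w]

open Topology in
omit [CompactSpace X] in
theorem tendsto_costOsc (hcont : Continuous h) (x : X) {U : ℕ → Set X}
    (hU : (𝓝 x).HasAntitoneBasis U) (w : E) :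
    Tendsto (fun k => costOsc h x (U k) w) atTop (𝓝 0) := by
  rw [Metric.tendsto_nhds]
  intro ε hε
  have hV : {y | |h (y, w) - h (x, w)| < ε / 2} ∈ 𝓝 x := by
    have : Continuous fun y => |h (y, w) - h (x, w)| := by fun_prop
    exact this.continuousAt.eventually_lt continuousAt_const (by simpa using half_pos hε)
  filter_upwards [hU.eventually_subset hV] with k hk
  rw [Real.dist_eq, sub_zero, abs_of_nonneg (costOsc_nonneg _ _ _)]
  have : costOsc h x (U k) w ≤ ε / 2 :=
    Real.iSup_le (fun y => (hk y.2).le) (half_pos hε).le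
  linarith

open Topology in
theorem exists_mem_nhds_integral_costOsc_lt [FirstCountableTopology X] [MeasurableSpace E]
    [BorelSpace E] (hcont : Continuous h) {μ : Measure E} {G : E → ℝ}
    (hG : ∀ x w, |h (x, w)| ≤ G w) (hGint : Integrable G μ) (x : X) {η : ℝ} (hη : 0 < η) :
    ∃ U ∈ 𝓝 x, ∫ w, costOsc h x U w ∂μ < η := by
  obtain ⟨U, hU⟩ := (𝓝 x).exists_antitone_basis
  have ht : Tendsto (fun k => ∫ w, costOsc h x (U k) w ∂μ) atTop (𝓝 (∫ _, (0 : ℝ) ∂μ)) := by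
    refine tendsto_integral_of_dominated_convergence (fun w => 2 * G w)
      (fun k => (measurable_costOsc hcont x (U k)).aestronglyMeasurable) (hGint.const_mul 2)
      (fun k => ae_of_all _ fun w => ?_) (ae_of_all _ fun w => tendsto_costOsc hcont x hU w)
    rw [Real.norm_eq_abs, abs_of_nonneg (costOsc_nonneg _ _ _)]
    exact costOsc_le hG x (U k) w
  rw [integral_zero] at ht
  obtain ⟨k, hk⟩ := (ht.eventually_lt_const hη).exists
  exact ⟨U k, hU.mem k, hk⟩

theorem abs_cost_le_envelope_add (hcont : Continuous h) {c : ℝ} (hc : ∀ z, c ≤ h z) (x : X)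
    (w : E) : |h (x, w)| ≤ envelope h w + |c| := by
  have h0 : 0 ≤ envelope h w := le_max_right _ _
  refine abs_le.2 ⟨?_, ?_⟩
  · linarith [hc (x, w), neg_abs_le c]
  · linarith [le_envelope hcont x w, abs_nonneg c]

theorem measurable_envelope [MeasurableSpace E] [BorelSpace E] (hcont : Continuous h) :
    Measurable (envelope h) :=
  (lowerSemicontinuous_ciSup
    (fun w => (isCompact_range (f := fun x : X => h (x, w)) (by fun_prop)).bddAbove) fun x =>
    Continuous.lowerSemicontinuous (by fun_prop)).measurable.max measurable_const

theorem memLp_envelope [MeasurableSpace E] [BorelSpace E] (hcont : Continuous h) {μ : Measure E}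
    {q : ℝ} (hq : 0 < q) (hψ : ∫⁻ w, ENNReal.ofReal (envelope h w ^ q) ∂μ < ∞) :
    MemLp (envelope h) (ENNReal.ofReal q) μ := by
  have hm := measurable_envelope hcont
  refine (integrable_norm_rpow_iff hm.aestronglyMeasurable (by simpa using hq) (by simp)).1 ?_
  rw [ENNReal.toReal_ofReal hq.le]
  refine ⟨(hm.norm.pow_const q).aestronglyMeasurable, ?_⟩
  refine lt_of_eq_of_lt (lintegral_congr fun w => ?_) hψ
  have h0 : 0 ≤ envelope h w := le_max_right _ _
  simp only [Real.norm_of_nonneg h0]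
  rw [Real.enorm_of_nonneg (Real.rpow_nonneg h0 q)]

/-- A uniform estimate on a neighbourhood of `x`, from estimates at `x` and for the oscillation. -/
theorem abs_integral_cost_sub_lt_of_mem [MeasurableSpace E] [BorelSpace E] (hcont : Continuous h)
    {μ ν : Measure E} (hμ : ∀ x, Integrable (fun w => h (x, w)) μ)
    (hν : ∀ x, Integrable (fun w => h (x, w)) ν) {x y : X} {U : Set X} (hy : y ∈ U)
    (hUμ : Integrable (costOsc h x U) μ) (hUν : Integrable (costOsc h x U) ν) {η : ℝ}
    (hosc : ∫ w, costOsc h x U w ∂μ < η)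
    (hoscν : ∫ w, costOsc h x U w ∂ν - ∫ w, costOsc h x U w ∂μ < η)
    (hx : |∫ w, h (x, w) ∂ν - ∫ w, h (x, w) ∂μ| < η) :
    |∫ w, h (y, w) ∂ν - ∫ w, h (y, w) ∂μ| < 4 * η := by
  have key : ∀ ρ : Measure E, (∀ x, Integrable (fun w => h (x, w)) ρ) →
      Integrable (costOsc h x U) ρ →
      |∫ w, h (y, w) ∂ρ - ∫ w, h (x, w) ∂ρ| ≤ ∫ w, costOsc h x U w ∂ρ := by
    intro ρ h1 h2
    rw [← integral_sub (h1 y) (h1 x)]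
    exact (abs_integral_le_integral_abs).trans (integral_mono ((h1 y).sub (h1 x)).abs h2
      fun w => abs_cost_sub_le_costOsc hcont hy w)
  -- Moving from `y` to `x` costs less than `2 * η` under `ν` and less than `η` under `μ`; the
  -- comparison at `x` costs the fourth `η`.
  have h1 := abs_le.1 (key μ hμ hUμ)
  have h2 := abs_le.1 (key ν hν hUν)
  have h3 := abs_lt.1 hx
  exact abs_lt.2 ⟨by linarith [h1.1, h1.2], by linarith [h1.1, h1.2]⟩

end

/-! ### The finite cover and the union bound. -/

theorem theorem4p6 {X E : Type*}
    [TopologicalSpace X] [PolishSpace X] [CompactSpace X] [Nonempty X]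
    [TopologicalSpace E] [PolishSpace E] [MeasurableSpace E] [BorelSpace E]
    (h : X × E → ℝ) (hcont : Continuous h) (hbdd : BddBelow (Set.range h))
    (hcpt : ∀ c : ℝ, IsCompact {z : X × E | h z ≤ c})
    (q : ℝ) (hq : 1 < q) (μ : Measure E) [IsProbabilityMeasure μ]
    (hψ : ∫⁻ w, ENNReal.ofReal (envelope h w ^ q) ∂μ < ∞)
    (ε : ℝ) (hε : 0 < ε) :
    limsup (fun n : ℕ => (n : ℝ≥0∞) ^ (q - 1) *
      Measure.pi (fun _ : Fin n => μ)
        {w : Fin n → E | ε ≤ |optValue h (empiricalMeasure w) - optValue h μ|}) atTop < ∞ := by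
  obtain ⟨c, hc⟩ := id hbdd
  have hc' : ∀ z, c ≤ h z := fun z => hc ⟨z, rfl⟩
  have hq0 : 0 < q := by linarith
  have hq1 : (1 : ℝ≥0∞) ≤ ENNReal.ofReal q := by simpa using hq.le
  -- Off the bad events the values differ by at most `4 * (ε / 5)`, which is strictly below `ε`.
  have hη : 0 < ε / 5 := by positivity
  set G : E → ℝ := fun w => envelope h w + |c|
  have hG : ∀ x w, |h (x, w)| ≤ G w := abs_cost_le_envelope_add hcont hc'
  have hGq : MemLp G (ENNReal.ofReal q) μ := (memLp_envelope hcont hq0 hψ).add (memLp_const _)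
  have hintμ := integrable_cost hcont hbdd hq hψ
  have hmeas : ∀ x, Measurable fun w => h (x, w) := fun x =>
    Continuous.measurable (by fun_prop)
  have hhq : ∀ x, MemLp (fun w => h (x, w)) (ENNReal.ofReal q) μ := fun x =>
    hGq.mono' (hmeas x).aestronglyMeasurable (ae_of_all _ fun w => hG x w)
  have hoq : ∀ x U, MemLp (costOsc h x U) (ENNReal.ofReal q) μ := fun x U =>
    (hGq.const_mul 2).mono' (measurable_costOsc hcont x U).aestronglyMeasurable
      (ae_of_all _ fun w => by
        rw [Real.norm_of_nonneg (costOsc_nonneg _ _ _)]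
        exact costOsc_le hG x U w)
  choose U hU hUosc using fun x =>
    exists_mem_nhds_integral_costOsc_lt hcont hG (hGq.integrable hq1) x hη
  obtain ⟨t, -, ht⟩ := isCompact_univ.elim_nhds_subcover U fun x _ => hU x
  choose C₁ hC₁ using fun x =>
    eventually_rpow_mul_measureReal_pi_average_sub_ge_le (μ := μ) (hmeas x) hq (hhq x) hη
  -- The tail bound is one-sided; the negated cost supplies the lower deviations.
  choose C₂ hC₂ using fun x => eventually_rpow_mul_measureReal_pi_average_sub_ge_le (μ := μ)
    (f := fun w => -h (x, w)) (hmeas x).neg hq (hhq x).neg hη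
  choose C₃ hC₃ using fun x => eventually_rpow_mul_measureReal_pi_average_sub_ge_le (μ := μ)
    (measurable_costOsc hcont x (U x)) hq (hoq x (U x)) hη
  have hall : ∀ᶠ n : ℕ in atTop, ∀ x ∈ t, _ :=
    (t.eventually_all).2 fun x _ => (hC₁ x).and ((hC₂ x).and (hC₃ x))
  refine lt_of_le_of_lt (limsup_le_of_le (by isBoundedDefault)
    (a := ENNReal.ofReal (∑ x ∈ t, (C₁ x + (C₂ x + C₃ x)))) ?_) ENNReal.ofReal_lt_top
  filter_upwards [hall, eventually_ge_atTop 1] with n hn hn1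
  have hn0 : n ≠ 0 := by omega
  have hnpos : (0 : ℝ) < n := by exact_mod_cast hn1
  set P := Measure.pi fun _ : Fin n => μ
  have hsub : {w : Fin n → E | ε ≤ |optValue h (empiricalMeasure w) - optValue h μ|} ⊆
      ⋃ x ∈ t, ({w | ε / 5 ≤ (n : ℝ)⁻¹ * ∑ i, h (x, w i) - ∫ w, h (x, w) ∂μ} ∪
        ({w | ε / 5 ≤ (n : ℝ)⁻¹ * ∑ i, -h (x, w i) - ∫ w, -h (x, w) ∂μ} ∪
        {w | ε / 5 ≤ (n : ℝ)⁻¹ * ∑ i, costOsc h x (U x) (w i) -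
          ∫ w, costOsc h x (U x) w ∂μ})) := by
    intro w hw
    by_contra hcon
    simp only [Set.mem_iUnion, Set.mem_union, Set.mem_ofPred_eq, not_exists, not_or, not_le,
      Finset.sum_neg_distrib, integral_neg, ← integral_empiricalMeasure, mul_neg] at hcon
    have := isProbabilityMeasure_empiricalMeasure hn0 w
    have hν := fun x => integrable_empiricalMeasure hn0 w fun e => h (x, e)
    have hunif : ∀ y, |∫ e, h (y, e) ∂(empiricalMeasure w) - ∫ e, h (y, e) ∂μ| ≤ 4 * (ε / 5) := by
      intro y
      obtain ⟨x, hxt, hyx⟩ := Set.mem_iUnion₂.1 (ht (Set.mem_univ y))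
      obtain ⟨h1, h2, h3⟩ := hcon x hxt
      have hab := integral_empiricalMeasure w fun e => h (x, e)
      exact (abs_integral_cost_sub_lt_of_mem hcont hintμ hν hyx ((hoq x (U x)).integrable hq1)
        (integrable_empiricalMeasure hn0 w _) (hUosc x) h3
        (by rw [abs_lt, hab]; constructor <;> linarith)).le
    have := abs_ciInf_sub_ciInf_le (bddBelow_range_integral_cost hbdd _ hν)
      (bddBelow_range_integral_cost hbdd μ hintμ) hunif
    have hw' : ε ≤ |optValue h (empiricalMeasure w) - optValue h μ| := hw
    rw [optValue, optValue] at hw'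
    linarith
  have hnq : 0 ≤ (n : ℝ) ^ (q - 1) := by positivity
  have hreal : (n : ℝ) ^ (q - 1) *
      P.real {w : Fin n → E | ε ≤ |optValue h (empiricalMeasure w) - optValue h μ|} ≤
      ∑ x ∈ t, (C₁ x + (C₂ x + C₃ x)) := by
    refine (mul_le_mul_of_nonneg_left ((measureReal_mono hsub (measure_ne_top _ _)).trans
      (measureReal_biUnion_finset_le _ _)) hnq).trans ?_
    rw [Finset.mul_sum]
    refine Finset.sum_le_sum fun x hx => ?_
    refine (mul_le_mul_of_nonneg_left ((measureReal_union_le _ _).trans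
      (add_le_add le_rfl (measureReal_union_le _ _))) hnq).trans ?_
    rw [mul_add, mul_add]
    obtain ⟨h1, h2, h3⟩ := hn x hx
    exact add_le_add h1 (add_le_add h2 h3)
  refine le_trans (le_of_eq ?_) (ENNReal.ofReal_le_ofReal hreal)
  rw [ENNReal.ofReal_mul hnq, ofReal_measureReal, ← ENNReal.ofReal_rpow_of_pos hnpos,
    ENNReal.ofReal_natCast]
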